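/- **Conventions.** Let $J$ be a finite totally ordered set, $g_{\alpha\beta}\in\mathbb R$ ($\alpha\ne\beta\in J$) with $g_{\alpha\beta}\neq 0$ for $\alpha<\beta$, and $x_\alpha\in\mathbb C$ ($\alpha\in J$). These data define the unital associative $\mathbb C$-algebra with generators $D_\alpha$, $\alpha\in J$, and relations $$g_{\alpha\beta}D_\alpha D_\beta-g_{\beta\alpha}D_\beta D_\alpha=x_\beta D_\alpha-x_\alpha D_\beta\qquad(\alpha<\beta).\tag{1}$$ For $J=\{1,\dots,N\}$ it is called a *Diffusion algebra* if the ordered monomials $D_{\alpha_1}^{k_1}\cdots D_{\alpha_N}^{k_N}$, where $\alpha_1>\dots>\alpha_N$ are all the indices and $k_j\in\mathbb N_0$, form a linear basis. Write $:\!D_\alpha D_\beta\!:\;=D_{\min(\alpha,\beta)}D_{\max(\alpha,\beta)}$ for $\alpha\neq\beta$. **Building blocks.** Given relations (1) on $J$, put $I=\{\alpha: x_\alpha\ne0\}$ and $U=\{\alpha:x_\alpha=0\}$. Assume that $U$ is connective: it is empty, or any two of its elements are joined by a finite sequence in $U$ whose consecutive members $r,s$ satisfy $g_{rs}g_{sr}\neq0$.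 Call $U$ *of type $S$* if it is empty or $g_{ir}g_{ri}\ne0$ for some $r\in U$, $i\in I$; say that $U$ is *in position $\bullet$* if there are $i<j$ in $I$ with no element of $I$ strictly between them and $i<t<j$ for all $t\in U$, and *in position $\circ$* otherwise. The relations (1) form a *building block* $X(I,U)$ if the relations that involve a generator with index in $I$ have one of the following forms, with real constants. (All coefficients of $D_\alpha D_\beta$, $\alpha<\beta$, are non-zero, as required in (1).) * $|I|\ge3$ and $g[D_i,D_j]=x_jD_i-x_iD_j$ for $i,j\in I$, together with one of: * $A_I(I,S)$: $U$ is of type $S$ and $g_s[D_s,D_i]=x_iD_s$ for $s\in U,\ i\in I$; * $A_I(I,T^\circ)$: $U$ is in position $\circ$ and $c:\!D_iD_t\!:\;=-x_iD_t$ for $t\in U,\ i\in I$; * $A_I(I,T^\bullet)$: $U$ is in position $\bullet$, and for $t\in U$, $i\in I$: $c^+D_iD_t=-x_iD_t$ if $i<t$ and $c^-D_tD_i=x_iD_t$ if $i>t$. * $|I|\ge3$ and $(h_i-h_j)D_iD_j=x_jD_i-x_iD_j$ for $i<j$ in $I$, together with one of: * $A_{II}(I,T^\circ)$: $U$ is in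 position $\circ$ and $(h_i+c):\!D_iD_t\!:\;=-x_iD_t$ for $t\in U,\ i\in I$; * $A_{II}(I,T^\bullet)$: $U$ is in position $\bullet$, and for $t\in U$, $i\in I$: $(h_i+c^+)D_iD_t=-x_iD_t$ if $i<t$ and $(c^--h_i)D_tD_i=x_iD_t$ if $i>t$. * $I=\{\mathbf i<\mathbf j\}$ and $gD_{\mathbf i}D_{\mathbf j}-(g-\Lambda)D_{\mathbf j}D_{\mathbf i}=x_{\mathbf j}D_{\mathbf i}-x_{\mathbf i}D_{\mathbf j}$, together with one of: * $B(\{\mathbf i,\mathbf j\},S)$: $U$ is of type $S$, and for $s\in U$: $g_sD_{\mathbf i}D_s-(g_s-\Lambda)D_sD_{\mathbf i}=-x_{\mathbf i}D_s$ and $g_sD_sD_{\mathbf j}-(g_s-\Lambda)D_{\mathbf j}D_s=x_{\mathbf j}D_s$; * $B(\{\mathbf i,\mathbf j\},T^\circ)$: $U$ is in position $\circ$, and for $t\in U$: $c:\!D_{\mathbf i}D_t\!:\;=-x_{\mathbf i}D_t$ and $(c-\Lambda):\!D_{\mathbf j}D_t\!:\;=-x_{\mathbf j}D_t$; * $B(\{\mathbf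 i,\mathbf j\},T^\bullet)$: $U$ is in position $\bullet$, and for $t\in U$: $c^+D_{\mathbf i}D_t=-x_{\mathbf i}D_t$ and $c^-D_tD_{\mathbf j}=x_{\mathbf j}D_t$. * $C(\{\mathbf i\},R)$: $I=\{\mathbf i\}$, and for $r\in U$: $g_rD_{\mathbf i}D_r-(g_r-\Lambda)D_rD_{\mathbf i}=-x_{\mathbf i}D_r$, where $\Lambda$ does not depend on $r$. * $D(R)$: $I=\emptyset$ (so all relations are $D_rD_s-q_{sr}D_sD_r=0$, $r<s$). **Blending.** Let $X_l(I,U_l)$, $l=1,\dots,K$ ($K\ge1$), be building blocks with the same $I$ and the same coefficients $x_i$, $g_{ij}$ for $i,j\in I$. Let $\mathcal I$ be the disjoint union of $I,U_1,\dots,U_K$ with a total order that restricts, for every $l$, to the order of the block $X_l$ on $I\cup U_l$. The *blended algebra* is the algebra with generators $D_a$, $a\in\mathcal I$, subject to the relations of every block $X_l$ and to $:\!D_aD_b\!:\;=0$ for all $a\in U_l$, $b\in U_m$ with $l\ne m$. **Theorem.** Every Diffusion algebra can be obtained by blending building blocks: for every $N\geq 0$ and every Diffusion algebra with generators $D_1,\dots,D_N$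 there are building blocks and a compatible order on $\mathcal I=\{1,\dots,N\}$ such that the Diffusion algebra is isomorphic to the blended algebra by an isomorphism of $\mathbb C$-algebras that sends $D_\alpha$ to $D_\alpha$ for each $\alpha$. -/

import Mathlib

namespace Diffusion

/-- The structure constants of an algebra with generators `D α`, `α : J`, and relations
`g α β D α D β - g β α D β D α = x β D α - x α D β` for `α < β`. -/
structure Relations (J : Type) [LinearOrder J] where
  /-- The real coefficients of the quadratic part (the values `g α α` play no role). -/
  g : J → J → ℝ
  /-- The complex coefficients of the linear part. -/
  x : J → ℂ
  /-- The coefficient of `D α D β` is non-zero for `α < β`; that of `D β D α` is arbitrary. -/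
  g_ne_zero : ∀ α β : J, α < β → g α β ≠ 0

namespace Relations

variable {J : Type} [LinearOrder J] (P : Relations J)

/-- The relation attached to the pair `α < β`, with every generator `D γ` replaced by `d γ`
in a complex algebra `A`: the left-hand side. -/
def lhs {A : Type} [Ring A] [Algebra ℂ A] (d : J → A) (α β : J) : A :=
  (P.g α β : ℂ) • (d α * d β) - (P.g β α : ℂ) • (d β * d α)

/-- The right-hand side of the relation attached to the pair `α < β`. -/
def rhs {A : Type} [Ring A] [Algebra ℂ A] (d : J → A) (α β : J) : A :=
  P.x β • d α - P.x α • d β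

/-- The defining relations, in the free algebra. -/
inductive Rel : FreeAlgebra ℂ J → FreeAlgebra ℂ J → Prop
  | quad (α β : J) (h : α < β) :
      Rel (P.lhs (FreeAlgebra.ι ℂ) α β) (P.rhs (FreeAlgebra.ι ℂ) α β)

/-- The complex unital associative algebra with generators `D α` and the given relations. -/
abbrev Alg : Type := RingQuot P.Rel

/-- The generators `D α`. -/
def D (α : J) : P.Alg := RingQuot.mkAlgHom ℂ P.Rel (FreeAlgebra.ι ℂ α)

/-- The ordered monomial `D α₁ ^ k α₁ * ⋯ * D αₙ ^ k αₙ`, where `α₁ > ⋯ > αₙ` are all the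
indices. -/
def monomial [Fintype J] (k : J → ℕ) : P.Alg :=
  (((Finset.univ : Finset J).sort (· ≥ ·)).map (fun α => P.D α ^ k α)).prod

/-- The algebra is a Diffusion algebra: the ordered monomials are a linear (PBW) basis. -/
def IsDiffusion [Fintype J] : Prop :=
  LinearIndependent ℂ P.monomial ∧ Submodule.span ℂ (Set.range P.monomial) = ⊤

/-- The indices with non-zero `x`. -/
def I : Set J := {α | P.x α ≠ 0}

/-- The indices with `x` equal to zero. In a building block `X(I, U)` this is the set `U`. -/
def R : Set J := {α | P.x α = 0}

/-- The connectivity condition on `R`: any two indices of `R` are joined by a finite sequence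
in `R` for whose consecutive members `g r s * g s r ≠ 0`. The empty set is admitted. -/
def Connective : Prop :=
  ∀ r ∈ P.R, ∀ s ∈ P.R,
    Relation.ReflTransGen (fun a b => a ∈ P.R ∧ b ∈ P.R ∧ P.g a b * P.g b a ≠ 0) r s

/-- `R`, if it is non-empty, is of type `S`: some `r ∈ R` and `i ∈ I` have
`g i r * g r i ≠ 0`. -/
def TypeS : Prop :=
  P.R.Nonempty → ∃ r ∈ P.R, ∃ i ∈ P.I, P.g i r * P.g r i ≠ 0

/-- The position of `R` in type `T•`: `R` lies between two consecutive elements of `I`. -/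
def Bullet : Prop :=
  ∃ i ∈ P.I, ∃ j ∈ P.I, i < j ∧ (∀ t ∈ P.R, i < t ∧ t < j) ∧ ∀ k ∈ P.I, ¬ (i < k ∧ k < j)

/-- For `i ∈ I` and `t ∈ R` the relation is `c :D i D t: = - x i D t`. For `t < i` the general
relation `g t i D t D i - g i t D i D t = x i D t` takes this form when `g t i = - c`. -/
def NormalRel (i t : J) (c : ℝ) : Prop :=
  (i < t → P.g i t = c ∧ P.g t i = 0) ∧ (t < i → P.g t i = -c ∧ P.g i t = 0)

/-- `g [D i, D j] = x j D i - x i D j` for all `i, j ∈ I`. -/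
def RelAI (g : ℝ) : Prop := ∀ i ∈ P.I, ∀ j ∈ P.I, i ≠ j → P.g i j = g

/-- `(h i - h j) D i D j = x j D i - x i D j` for all `i < j` in `I`. -/
def RelAII (h : J → ℝ) : Prop :=
  ∀ i ∈ P.I, ∀ j ∈ P.I, i < j → P.g i j = h i - h j ∧ P.g j i = 0

/-- `A_I(I, S)`: `g_s [D s, D i] = x i D s`. -/
def IsAIS : Prop :=
  3 ≤ P.I.ncard ∧ (∃ g, P.RelAI g) ∧ P.TypeS ∧
    ∃ gS : J → ℝ, ∀ s ∈ P.R, ∀ i ∈ P.I, P.g s i = gS s ∧ P.g i s = gS s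

/-- `A_I(I, T°)`: `c :D i D t: = - x i D t`. -/
def IsAICirc : Prop :=
  3 ≤ P.I.ncard ∧ (∃ g, P.RelAI g) ∧ ¬ P.Bullet ∧
    ∃ c : ℝ, ∀ t ∈ P.R, ∀ i ∈ P.I, P.NormalRel i t c

/-- `A_I(I, T•)`: `c⁺ D i D t = - x i D t` for `i < t` and `c⁻ D t D i = x i D t` for
`t < i`. -/
def IsAIBullet : Prop :=
  3 ≤ P.I.ncard ∧ (∃ g, P.RelAI g) ∧ P.Bullet ∧
    ∃ cp cm : ℝ, ∀ t ∈ P.R, ∀ i ∈ P.I,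
      (i < t → P.g i t = cp ∧ P.g t i = 0) ∧ (t < i → P.g t i = cm ∧ P.g i t = 0)

/-- `A_II(I, T°)`: `(h i + c) :D i D t: = - x i D t`. -/
def IsAIICirc : Prop :=
  3 ≤ P.I.ncard ∧ ¬ P.Bullet ∧ ∃ h : J → ℝ, P.RelAII h ∧
    ∃ c : ℝ, ∀ t ∈ P.R, ∀ i ∈ P.I, P.NormalRel i t (h i + c)

/-- `A_II(I, T•)`: `(h i + c⁺) D i D t = - x i D t` for `i < t` and
`(c⁻ - h i) D t D i = x i D t` for `t < i`. -/
def IsAIIBullet : Prop :=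
  3 ≤ P.I.ncard ∧ P.Bullet ∧ ∃ h : J → ℝ, P.RelAII h ∧
    ∃ cp cm : ℝ, ∀ t ∈ P.R, ∀ i ∈ P.I,
      (i < t → P.g i t = h i + cp ∧ P.g t i = 0) ∧
      (t < i → P.g t i = cm - h i ∧ P.g i t = 0)

/-- `B({i, j}, S)`, with `Λ = g i j - g j i`: `g_s D i D s - (g_s - Λ) D s D i = - x i D s` and
`g_s D s D j - (g_s - Λ) D j D s = x j D s`. -/
def IsBS : Prop :=
  ∃ i j : J, i < j ∧ P.I = {i, j} ∧ P.TypeS ∧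
    ∃ gS : J → ℝ, ∀ s ∈ P.R,
      P.g i s = gS s ∧ P.g s i = gS s - (P.g i j - P.g j i) ∧
      P.g s j = gS s ∧ P.g j s = gS s - (P.g i j - P.g j i)

/-- `B({i, j}, T°)`, with `Λ = g i j - g j i`: `c :D i D t: = - x i D t` and
`(c - Λ) :D j D t: = - x j D t`. -/
def IsBCirc : Prop :=
  ∃ i j : J, i < j ∧ P.I = {i, j} ∧ ¬ P.Bullet ∧
    ∃ c : ℝ, ∀ t ∈ P.R, P.NormalRel i t c ∧ P.NormalRel j t (c - (P.g i j - P.g j i))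

/-- `B({i, j}, T•)`, where `i < t < j` for all `t`: `c⁺ D i D t = - x i D t` and
`c⁻ D t D j = x j D t`. -/
def IsBBullet : Prop :=
  ∃ i j : J, i < j ∧ P.I = {i, j} ∧ P.Bullet ∧
    ∃ cp cm : ℝ, ∀ t ∈ P.R,
      (P.g i t = cp ∧ P.g t i = 0) ∧ (P.g t j = cm ∧ P.g j t = 0)

/-- `C({i}, R)`: `g_r D i D r - (g_r - Λ) D r D i = - x i D r`. -/
def IsC : Prop :=
  ∃ i : J, P.I = {i} ∧
    ∃ (L : ℝ) (gR : J → ℝ), ∀ r ∈ P.R, P.g i r = gR r ∧ P.g r i = gR r - L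

/-- `D(R)`: all `x` vanish, so that the relations are `D r D s - q D s D r = 0`. -/
def IsD : Prop := P.I = ∅

/-- The elementary building blocks. -/
def IsBuildingBlock : Prop :=
  P.Connective ∧
    (P.IsAIS ∨ P.IsAICirc ∨ P.IsAIBullet ∨ P.IsAIICirc ∨ P.IsAIIBullet ∨
      P.IsBS ∨ P.IsBCirc ∨ P.IsBBullet ∨ P.IsC ∨ P.IsD)

end Relations

/-- A building block `X(I, U)` on its own ordered index set, with `I = rels.I`,
`U = rels.R`. -/
structure Block where
  /-- The index set `I ∪ U`. -/
  J : Type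
  /-- The order of the indices. -/
  ord : LinearOrder J
  /-- The relations. -/
  rels : Relations J
  /-- The relations are those of one of the families. -/
  isBuildingBlock : rels.IsBuildingBlock

attribute [instance] Block.ord

/-- The normally ordered product `:d α d β:`. -/
def normalProd {J A : Type} [LinearOrder J] [Mul A] (d : J → A) (α β : J) : A :=
  if α < β then d α * d β else d β * d α

/-- The input of the blending procedure: blocks `X 0, …, X (K - 1)` sharing `I` together with
the relations on it, and an ordered set `J` labelled by `I` and the sets `U` of the blocks,
whose order is compatible with the orders in the blocks. -/
structure Blending (J : Type) [LinearOrder J] where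
  /-- The number of blocks. -/
  K : ℕ
  K_pos : 0 < K
  /-- The blocks. -/
  X : Fin K → Block
  /-- The labelling of elements of `J` by the indices of the `l`-th block. That it is an order
  embedding is the compatibility of the orders. -/
  φ : ∀ l, (X l).J ↪o J
  /-- Every element of `J` carries a label. -/
  cover : ∀ a : J, ∃ l, ∃ α, φ l α = a
  /-- The sets `I` of all blocks are the same. -/
  image_I : ∀ l m, φ l '' (X l).rels.I = φ m '' (X m).rels.I
  /-- The sets `U` of different blocks are disjoint. -/
  disjoint_U : ∀ l m, l ≠ m → Disjoint (φ l '' (X l).rels.R) (φ m '' (X m).rels.R)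
  /-- The coefficients `x` on `I` agree. -/
  same_x : ∀ l m, ∀ α ∈ (X l).rels.I, ∀ α' ∈ (X m).rels.I, φ l α = φ m α' →
    (X l).rels.x α = (X m).rels.x α'
  /-- The coefficients `g` on `I` agree. -/
  same_g : ∀ l m, ∀ α ∈ (X l).rels.I, ∀ β ∈ (X l).rels.I, ∀ α' ∈ (X m).rels.I,
    ∀ β' ∈ (X m).rels.I, α ≠ β → φ l α = φ m α' → φ l β = φ m β' →
    (X l).rels.g α β = (X m).rels.g α' β'

namespace Blending

variable {J : Type} [LinearOrder J] (B : Blending J)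

/-- The relations of the blended algebra: those of every block, and `:D a D b: = 0` for
`a`, `b` in the sets `U` of different blocks. -/
inductive Rel : FreeAlgebra ℂ J → FreeAlgebra ℂ J → Prop
  | block (l : Fin B.K) (α β : (B.X l).J) (h : α < β) :
      Rel ((B.X l).rels.lhs (fun γ => FreeAlgebra.ι ℂ (B.φ l γ)) α β)
        ((B.X l).rels.rhs (fun γ => FreeAlgebra.ι ℂ (B.φ l γ)) α β)
  | cross (l m : Fin B.K) (h : l ≠ m) (a : (B.X l).J) (b : (B.X m).J)
      (ha : a ∈ (B.X l).rels.R) (hb : b ∈ (B.X m).rels.R) :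
      Rel (normalProd (FreeAlgebra.ι ℂ) (B.φ l a) (B.φ m b)) 0

/-- The blended algebra. -/
abbrev Alg : Type := RingQuot B.Rel

/-- The generators of the blended algebra. -/
def D (α : J) : B.Alg := RingQuot.mkAlgHom ℂ B.Rel (FreeAlgebra.ι ℂ α)

end Blending

end Diffusion

/-!
Only the linear independence of the ordered monomials of degree at most two is needed. Reordering
`D i D j D k`, `i < j < k`, in the two possible ways and comparing coefficients (`overlap`,
`IsDiffusion.coeff_eq_zero`) gives, with `Λ α β = g α β - g β α` (`asym`), the conditions collected
in `IsConsistent`: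

* `g β α = 0` or `Λ γ α = Λ γ β` whenever `α < β` and `x γ ≠ 0`;
* three linear relations, one for each position of an index `t` relative to a pair `i < j` with
  `x i * x j ≠ 0`.

They do not mix indices `r`, `s` with `x r = x s = 0` unless `g r s * g s r ≠ 0`. So the set of
indices with `x = 0` is split into the classes generated by this relation (`linked`). Between
different classes `g s r = 0` for `r < s`, and the relation is `D r D s = 0`, which is the one
imposed by blending. It remains to see that the relations on `I` and a single class `U` form a
building block (`IsConsistent.isBuildingBlock`).

This rests on two facts. First, `Λ i t` does not depend on `t ∈ U` (`IsConsistent.asym_eq`).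
Second, seen from a pair in `I`, every third index either has two-sided relations with both, all
determined by one coefficient, or one-sided relations with both (`IsConsistent.pair_dichotomy`).
Applied to three indices in `I` it separates the families `A_I` and `A_II`; applied to `t ∈ U` it
separates type `S` from type `T`. In type `T`, write `Λ i j = h i - h j` on `I`; then `Λ i t - h i`
takes the same value at all `i` on one side of some `t`. Hence it is constant on `I` unless `U` lies
in a single gap of `I`, and then it is constant on either side of the gap: these are the positions
`∘` and `•` (`IsConsistent.circ`, `IsConsistent.bullet`).
-/

namespace Diffusion

/-! ### The consistency conditions -/

namespace Relations

variable {J : Type} [LinearOrder J] {P : Relations J}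

/-- The antisymmetric part `Λ α β = g α β - g β α` of the quadratic coefficients. -/
def asym (P : Relations J) (α β : J) : ℝ := P.g α β - P.g β α

/-- The conditions on the coefficients under which the two ways of reordering `D α D β D γ`,
`α < β < γ`, agree, sorted by which of the `x` they require to be non-zero. -/
structure IsConsistent (P : Relations J) : Prop where
  transport : ∀ α β γ, α < β → γ ≠ α → γ ≠ β → γ ∈ P.I →
    P.g β α = 0 ∨ P.asym γ α = P.asym γ β
  left : ∀ t i j, t < i → i < j → i ∈ P.I → j ∈ P.I → P.g t j - P.g t i = P.asym i j
  middle : ∀ i t j, i < t → t < j → i ∈ P.I → j ∈ P.I → P.g j t = P.g t i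
  right : ∀ i j t, i < j → j < t → i ∈ P.I → j ∈ P.I → P.g i t - P.g j t = P.asym i j

/-! ### Consequences for one or two indices in `I` -/

theorem ne_of_mem_I_of_mem_R {i t : J} (hi : i ∈ P.I) (ht : t ∈ P.R) : t ≠ i := by
  rintro rfl
  exact hi ht

/-- In the zero-product case only the coefficient of the product in increasing order survives, and
it is determined by `asym`. -/
theorem coeff_of_lt {i t : J} (h : P.g i t * P.g t i = 0) (hit : i < t) :
    P.g i t = P.asym i t ∧ P.g t i = 0 := by
  have h0 := (mul_eq_zero.mp h).resolve_left (P.g_ne_zero i t hit)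
  simp [asym, h0]

theorem coeff_of_gt {i t : J} (h : P.g i t * P.g t i = 0) (hti : t < i) :
    P.g t i = -P.asym i t ∧ P.g i t = 0 := by
  have h0 := (mul_eq_zero.mp h).resolve_right (P.g_ne_zero t i hti)
  simp [asym, h0]

theorem asym_ne_zero {i t : J} (h : P.g i t * P.g t i = 0) (hit : i ≠ t) : P.asym i t ≠ 0 := by
  rcases lt_or_gt_of_ne hit with hlt | hlt
  · rw [← (coeff_of_lt h hlt).1]
    exact P.g_ne_zero i t hlt
  · rw [← neg_ne_zero, ← (coeff_of_gt h hlt).1]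
    exact P.g_ne_zero t i hlt

/-- `asym i` is constant on a connective `U`, since `transport` applies to linked indices. -/
theorem IsConsistent.asym_eq (h : P.IsConsistent) (hconn : P.Connective) {i r s : J}
    (hi : i ∈ P.I) (hr : r ∈ P.R) (hs : s ∈ P.R) : P.asym i r = P.asym i s := by
  induction hconn r hr s hs with
  | refl => rfl
  | @tail b c _ hbc ih =>
    obtain ⟨hb, hc, hne⟩ := hbc
    have hbi := (ne_of_mem_I_of_mem_R hi hb).symm
    have hci := (ne_of_mem_I_of_mem_R hi hc).symm
    rw [ih hb]
    rcases lt_trichotomy b c with hlt | rfl | hlt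
    · exact (h.transport b c i hlt hbi hci hi).resolve_left (right_ne_zero_of_mul hne)
    · rfl
    · exact ((h.transport c b i hlt hci hbi hi).resolve_left (left_ne_zero_of_mul hne)).symm

theorem IsConsistent.pair_dichotomy_of_lt (h : P.IsConsistent) {i j t : J} (hi : i ∈ P.I)
    (hj : j ∈ P.I) (hij : i < j) (hti : t ≠ i) (htj : t ≠ j) :
    (P.g i t * P.g t i ≠ 0 ∧ P.g i t = P.g t j ∧ P.g t i = P.g j t ∧
      P.g t i = P.g i t - P.asym i j) ∨
    (P.g i t * P.g t i = 0 ∧ P.g j t * P.g t j = 0) := by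
  rcases lt_or_gt_of_ne hti with h1 | h1
  · have hp := P.g_ne_zero t i h1
    have hq := P.g_ne_zero t j (h1.trans hij)
    have e := h.left t i j h1 hij hi hj
    have hA := h.transport t i j h1 htj.symm hij.ne' hj
    have hB := h.transport t j i (h1.trans hij) hti.symm hij.ne hi
    simp only [asym] at e hA hB ⊢
    rcases hA with hA | hA <;> rcases hB with hB | hB
    · right; simp [hA, hB]
    · exact absurd (by linarith) hq
    · exact absurd (by linarith) hp
    · have h2 : P.g i t = P.g t j := by linarith
      exact Or.inl ⟨mul_ne_zero (h2 ▸ hq) hp, h2, by linarith, by linarith⟩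
  rcases lt_or_gt_of_ne htj with h2 | h2
  · have hp := P.g_ne_zero i t h1
    have e := h.middle i t j h1 h2 hi hj
    have hA := h.transport i t j h1 hij.ne' htj.symm hj
    have hB := h.transport t j i h2 hti.symm hij.ne hi
    simp only [asym] at hA hB ⊢
    by_cases hu : P.g t i = 0
    · right; simp [hu, e]
    · have hA := hA.resolve_left hu
      have hB := hB.resolve_left (e ▸ hu)
      exact Or.inl ⟨mul_ne_zero hp hu, by linarith, by linarith, by linarith⟩
  · have hp := P.g_ne_zero i t h1
    have hq := P.g_ne_zero j t h2
    have e := h.right i j t hij h2 hi hj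
    have hA := h.transport i t j h1 hij.ne' htj.symm hj
    have hB := h.transport j t i h2 hij.ne hti.symm hi
    simp only [asym] at e hA hB ⊢
    rcases hA with hA | hA <;> rcases hB with hB | hB
    · right; simp [hA, hB]
    · exact absurd (by linarith) hq
    · exact absurd (by linarith) hp
    · have h3 : P.g t i = P.g j t := by linarith
      exact Or.inl ⟨mul_ne_zero hp (h3 ▸ hq), by linarith, h3, by linarith⟩

/-- Seen from two indices of `I`, a third index is either of type `S`, with all coefficients
determined by one of them, or of type `T`, with one-sided relations. -/
theorem IsConsistent.pair_dichotomy (h : P.IsConsistent) {i j t : J} (hi : i ∈ P.I)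
    (hj : j ∈ P.I) (hij : i ≠ j) (hti : t ≠ i) (htj : t ≠ j) :
    (P.g i t * P.g t i ≠ 0 ∧ P.g i t = P.g t j ∧ P.g t i = P.g j t ∧
      P.g t i = P.g i t - P.asym i j) ∨
    (P.g i t * P.g t i = 0 ∧ P.g j t * P.g t j = 0) := by
  rcases lt_or_gt_of_ne hij with hlt | hlt
  · exact h.pair_dichotomy_of_lt hi hj hlt hti htj
  · rcases h.pair_dichotomy_of_lt hj hi hlt htj hti with ⟨h1, h2, h3, h4⟩ | ⟨h1, h2⟩
    · refine Or.inl ⟨?_, h3.symm, h2.symm, ?_⟩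
      · rwa [← h2, ← h3, mul_comm]
      · simp only [asym] at h4 ⊢
        linarith
    · exact Or.inr ⟨h2, h1⟩

theorem IsConsistent.pair_eq (h : P.IsConsistent) {i j t : J} (hi : i ∈ P.I)
    (hj : j ∈ P.I) (hij : i ≠ j) (hti : t ≠ i) (htj : t ≠ j) (hne : P.g i t * P.g t i ≠ 0) :
    P.g i t = P.g t j ∧ P.g t i = P.g j t ∧ P.g t i = P.g i t - P.asym i j :=
  ((h.pair_dichotomy hi hj hij hti htj).resolve_right fun h' => hne h'.1).2

/-! ### The relations on `I` -/

/-- Three indices of `I`, one pair of which has a two-sided relation, have equal coefficients. -/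
theorem IsConsistent.triple_eq (h : P.IsConsistent) {i j k : J} (hi : i ∈ P.I) (hj : j ∈ P.I)
    (hk : k ∈ P.I) (hij : i ≠ j) (hik : i ≠ k) (hjk : j ≠ k) (hne : P.g i j * P.g j i ≠ 0) :
    P.g j i = P.g i j ∧ P.g i k = P.g i j ∧ P.g k i = P.g i j := by
  obtain ⟨a1, a2, a3⟩ := h.pair_eq hi hk hik hij.symm hjk hne
  have hne' : P.g k j * P.g j k ≠ 0 := by rwa [← a1, ← a2, mul_comm]
  obtain ⟨b1, b2, b3⟩ := h.pair_eq hk hi hik.symm hjk hij.symm hne'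
  have hne'' : P.g j i * P.g i j ≠ 0 := by rwa [mul_comm]
  obtain ⟨c1, c2, c3⟩ := h.pair_eq hj hk hjk hij hik hne''
  simp only [asym] at a3 b3 c3
  exact ⟨by linarith, by linarith, by linarith⟩

theorem exists_third (hcard : 3 ≤ P.I.ncard) (i j : J) : ∃ k ∈ P.I, k ≠ i ∧ k ≠ j := by
  have hlt : ({i, j} : Set J).ncard < P.I.ncard :=
    ((Set.ncard_insert_le _ _).trans (by rw [Set.ncard_singleton])).trans_lt hcard
  obtain ⟨k, hk, hk'⟩ := Set.exists_mem_notMem_of_ncard_lt_ncard hlt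
  simp only [Set.mem_insert_iff, Set.mem_singleton_iff, not_or] at hk'
  exact ⟨k, hk, hk'⟩

/-- A single two-sided relation on `I` makes all coefficients on `I` equal. -/
theorem IsConsistent.relAI (h : P.IsConsistent) (hcard : 3 ≤ P.I.ncard) {i j : J} (hi : i ∈ P.I)
    (hj : j ∈ P.I) (hij : i ≠ j) (hne : P.g i j * P.g j i ≠ 0) : P.RelAI (P.g i j) := by
  -- changing the second index keeps the coefficient and the hypothesis
  have move : ∀ a b c, a ∈ P.I → b ∈ P.I → c ∈ P.I → a ≠ b → a ≠ c → P.g a b * P.g b a ≠ 0 →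
      P.g a c = P.g a b ∧ P.g a c * P.g c a ≠ 0 := by
    intro a b c ha hb hc hab hac hne
    by_cases hbc : b = c
    · subst hbc
      exact ⟨rfl, hne⟩
    · obtain ⟨-, h2, h3⟩ := h.triple_eq ha hb hc hab hac hbc hne
      exact ⟨h2, by rw [h2, h3]; exact mul_self_ne_zero.mpr (left_ne_zero_of_mul hne)⟩
  intro a ha b hb hab
  by_cases hai : a = i
  · subst hai
    exact (move a j b ha hj hb hij hab hne).1
  · obtain ⟨e1, n1⟩ := move i j a hi hj ha hij (Ne.symm hai) hne
    obtain ⟨k, hk, hki, hka⟩ := exists_third hcard i a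
    have e2 := (h.triple_eq hi ha hk (Ne.symm hai) hki.symm hka.symm n1).1
    have e3 := (move a i b ha hi hb hai hab (by rwa [mul_comm])).1
    rw [e3, e2, e1]

/-- If all relations on `I` are one-sided, `asym` is additive on `I`. -/
theorem IsConsistent.asym_sub (h : P.IsConsistent)
    (h0 : ∀ i ∈ P.I, ∀ j ∈ P.I, i ≠ j → P.g i j * P.g j i = 0) {i j m : J} (hi : i ∈ P.I)
    (hj : j ∈ P.I) (hm : m ∈ P.I) (hij : i < j) : P.asym i j = P.asym i m - P.asym j m := by
  rcases lt_trichotomy m i with hmi | rfl | hmi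
  · have e := h.left m i j hmi hij hi hj
    have e1 := (coeff_of_gt (h0 i hi m hm hmi.ne') hmi).1
    have e2 := (coeff_of_gt (h0 j hj m hm (hmi.trans hij).ne') (hmi.trans hij)).1
    linarith
  · simp [asym]
  rcases lt_trichotomy m j with hmj | rfl | hmj
  · have e := h.left i m j hmi hmj hm hj
    have e1 := (coeff_of_lt (h0 i hi m hm hmi.ne) hmi).1
    have e2 := (coeff_of_lt (h0 i hi j hj hij.ne) hij).1
    simp only [asym] at e e1 e2 ⊢
    linarith
  · simp [asym]
  · have e := h.right i j m hij hmj hi hj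
    have e1 := (coeff_of_lt (h0 i hi m hm hmi.ne) hmi).1
    have e2 := (coeff_of_lt (h0 j hj m hm hmj.ne) hmj).1
    linarith

/-! ### One-sided relations between `I` and `U` -/

/-- If `asym` on `I` is the coboundary of `h` and the relations between `I` and `U` are one-sided,
then `asym i t - h i` takes the same value at any two `i` on the same side of `t`. -/
theorem IsConsistent.asym_sub_eq (hP : P.IsConsistent)
    (hT : ∀ t ∈ P.R, ∀ i ∈ P.I, P.g i t * P.g t i = 0) {h : J → ℝ}
    (hh : ∀ i ∈ P.I, ∀ j ∈ P.I, i < j → P.asym i j = h i - h j) {i j t : J} (hi : i ∈ P.I)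
    (hj : j ∈ P.I) (ht : t ∈ P.R) (hij : i < j) (hpos : ¬ (i < t ∧ t < j)) :
    P.asym i t - h i = P.asym j t - h j := by
  have e := hh i hi j hj hij
  rcases lt_or_gt_of_ne (ne_of_mem_I_of_mem_R hi ht) with h1 | h1
  · have e0 := hP.left t i j h1 hij hi hj
    have e1 := (coeff_of_gt (hT t ht i hi) h1).1
    have e2 := (coeff_of_gt (hT t ht j hj) (h1.trans hij)).1
    linarith
  · have h2 : j < t := lt_of_le_of_ne (not_lt.mp fun h2 => hpos ⟨h1, h2⟩)
      (ne_of_mem_I_of_mem_R hj ht).symm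
    have e0 := hP.right i j t hij h2 hi hj
    have e1 := (coeff_of_lt (hT t ht i hi) h1).1
    have e2 := (coeff_of_lt (hT t ht j hj) h2).1
    linarith

/-- In type `T` with `U` not in position `•`, the function `i ↦ asym i t - h i` is constant on `I`.
Equality at `i < j` is immediate unless all of `U` lies between `i` and `j`; in that case one passes to
the neighbours in `I` of an element of `U`, which do not enclose all of `U`. -/
theorem IsConsistent.circ [Finite J] (hP : P.IsConsistent) (hconn : P.Connective)
    (hT : ∀ t ∈ P.R, ∀ i ∈ P.I, P.g i t * P.g t i = 0) {h : J → ℝ}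
    (hh : ∀ i ∈ P.I, ∀ j ∈ P.I, i < j → P.asym i j = h i - h j) (hb : ¬ P.Bullet) :
    ∃ c : ℝ, ∀ t ∈ P.R, ∀ i ∈ P.I, P.NormalRel i t (h i + c) := by
  rcases P.R.eq_empty_or_nonempty with hR | ⟨s, hs⟩
  · exact ⟨0, by simp [hR]⟩
  rcases P.I.eq_empty_or_nonempty with hI | ⟨m, hm⟩
  · exact ⟨0, by simp [hI]⟩
  have side : ∀ i ∈ P.I, ∀ j ∈ P.I, ∀ t ∈ P.R, i ≤ j → ¬ (i < t ∧ t < j) →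
      P.asym i s - h i = P.asym j s - h j := by
    intro i hi j hj t ht hij hpos
    rcases hij.eq_or_lt with rfl | hij
    · rfl
    · rw [hP.asym_eq hconn hi hs ht, hP.asym_eq hconn hj hs ht]
      exact hP.asym_sub_eq hT hh hi hj ht hij hpos
  have const_lt : ∀ i ∈ P.I, ∀ j ∈ P.I, i < j → P.asym i s - h i = P.asym j s - h j := by
    intro i hi j hj hij
    by_cases hpos : i < s ∧ s < j
    · -- pass to the neighbours of `s` in `I`: some element of `U` is not between them
      obtain ⟨i', ⟨hi', hi's⟩, hmax⟩ := Set.exists_max_image {k | k ∈ P.I ∧ k < s} id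
        (Set.toFinite _) ⟨i, hi, hpos.1⟩
      obtain ⟨j', ⟨hj', hj's⟩, hmin⟩ := Set.exists_min_image {k | k ∈ P.I ∧ s < k} id
        (Set.toFinite _) ⟨j, hj, hpos.2⟩
      have hij' : i' < j' := hi's.trans hj's
      obtain ⟨t, ht, htpos⟩ : ∃ t ∈ P.R, ¬ (i' < t ∧ t < j') := by
        by_contra! hcon
        refine hb ⟨i', hi', j', hj', hij', hcon, fun k hk hk' => ?_⟩
        rcases lt_or_gt_of_ne (ne_of_mem_I_of_mem_R hk hs) with hlt | hlt
        · exact absurd hk'.2 (not_lt.mpr (hmin k ⟨hk, hlt⟩))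
        · exact absurd hk'.1 (not_lt.mpr (hmax k ⟨hk, hlt⟩))
      rw [side i hi i' hi' s hs (hmax i ⟨hi, hpos.1⟩) fun h' => lt_asymm h'.2 hi's,
        side i' hi' j' hj' t ht hij'.le htpos,
        side j' hj' j hj s hs (hmin j ⟨hj, hpos.2⟩) fun h' => lt_asymm h'.1 hj's]
    · exact side i hi j hj s hs hij.le hpos
  have const : ∀ i ∈ P.I, P.asym i s - h i = P.asym m s - h m := by
    intro i hi
    rcases lt_trichotomy i m with hlt | rfl | hlt
    · exact const_lt i hi m hm hlt
    · rfl
    · exact (const_lt m hm i hi hlt).symm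
  refine ⟨P.asym m s - h m, fun t ht i hi => ?_⟩
  have e : P.asym i t = h i + (P.asym m s - h m) := by
    rw [← const i hi, hP.asym_eq hconn hi ht hs]
    ring
  rw [← e]
  exact ⟨coeff_of_lt (hT t ht i hi), coeff_of_gt (hT t ht i hi)⟩

theorem IsConsistent.bullet (hP : P.IsConsistent) (hconn : P.Connective)
    (hT : ∀ t ∈ P.R, ∀ i ∈ P.I, P.g i t * P.g t i = 0) {h : J → ℝ}
    (hh : ∀ i ∈ P.I, ∀ j ∈ P.I, i < j → P.asym i j = h i - h j) (hb : P.Bullet) :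
    ∃ cp cm : ℝ, ∀ t ∈ P.R, ∀ i ∈ P.I,
      (i < t → P.g i t = h i + cp ∧ P.g t i = 0) ∧
      (t < i → P.g t i = cm - h i ∧ P.g i t = 0) := by
  obtain ⟨a, ha, b, hb, hab, hbetween, hcons⟩ := hb
  rcases P.R.eq_empty_or_nonempty with hR | ⟨s, hs⟩
  · exact ⟨0, 0, by simp [hR]⟩
  refine ⟨P.asym a s - h a, h b - P.asym b s, fun t ht i hi => ⟨fun hit => ?_, fun hti => ?_⟩⟩
  · obtain ⟨e1, e2⟩ := coeff_of_lt (hT t ht i hi) hit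
    have hia : i ≤ a := not_lt.mp fun hai => hcons i hi ⟨hai, hit.trans (hbetween t ht).2⟩
    have e3 : P.asym i t - h i = P.asym a t - h a := by
      rcases hia.eq_or_lt with rfl | hia
      · rfl
      · exact hP.asym_sub_eq hT hh hi ha ht hia fun h' => lt_asymm h'.2 (hbetween t ht).1
    rw [hP.asym_eq hconn ha ht hs] at e3
    exact ⟨by linarith, e2⟩
  · obtain ⟨e1, e2⟩ := coeff_of_gt (hT t ht i hi) hti
    have hbi : b ≤ i := not_lt.mp fun hib => hcons i hi ⟨(hbetween t ht).1.trans hti, hib⟩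
    have e3 : P.asym b t - h b = P.asym i t - h i := by
      rcases hbi.eq_or_lt with rfl | hbi
      · rfl
      · exact hP.asym_sub_eq hT hh hb hi ht hbi fun h' => lt_asymm h'.1 (hbetween t ht).2
    rw [hP.asym_eq hconn hb ht hs] at e3
    exact ⟨by linarith, e2⟩

/-! ### Consistent relations form a building block -/

theorem IsConsistent.isBuildingBlock_of_relAI [Finite J] (h : P.IsConsistent)
    (hconn : P.Connective) (hcard : 3 ≤ P.I.ncard) {g : ℝ} (hg : P.RelAI g) :
    P.IsAIS ∨ P.IsAICirc ∨ P.IsAIBullet := by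
  have hasym : ∀ i ∈ P.I, ∀ j ∈ P.I, P.asym i j = 0 := by
    intro i hi j hj
    by_cases hij : i = j
    · simp [asym, hij]
    · simp [asym, hg i hi j hj hij, hg j hj i hi (Ne.symm hij)]
  by_cases hS : ∃ r ∈ P.R, ∃ i ∈ P.I, P.g i r * P.g r i ≠ 0
  · obtain ⟨r, hr, i₀, hi₀, hne⟩ := hS
    have hri₀ := ne_of_mem_I_of_mem_R hi₀ hr
    have h0 : ∀ i ∈ P.I, P.asym i r = 0 := by
      intro i hi
      by_cases hii : i = i₀
      · subst hii
        obtain ⟨k, hk, hki, -⟩ := exists_third hcard i i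
        have e := (h.pair_eq hi hk hki.symm hri₀ (ne_of_mem_I_of_mem_R hk hr) hne).2.2
        rw [hasym i hi k hk] at e
        simp only [asym]
        linarith
      · obtain ⟨e1, e2, e3⟩ := h.pair_eq hi₀ hi (Ne.symm hii) hri₀ (ne_of_mem_I_of_mem_R hi hr) hne
        rw [hasym i₀ hi₀ i hi] at e3
        simp only [asym]
        linarith
    have hsymm : ∀ s ∈ P.R, ∀ i ∈ P.I, P.g s i = P.g i s := by
      intro s hs i hi
      have e := h.asym_eq hconn hi hs hr
      rw [h0 i hi] at e
      simp only [asym] at e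
      linarith
    refine Or.inl ⟨hcard, ⟨g, hg⟩, fun _ => ⟨r, hr, i₀, hi₀, hne⟩, fun s => P.g i₀ s,
      fun s hs i hi => ?_⟩
    have key : P.g i s = P.g i₀ s := by
      by_cases hii : i = i₀
      · rw [hii]
      · have hsi := ne_of_mem_I_of_mem_R hi hs
        have hne' : P.g i s * P.g s i ≠ 0 := fun h' =>
          asym_ne_zero h' hsi.symm (by rw [asym, hsymm s hs i hi, sub_self])
        rw [(h.pair_eq hi hi₀ hii hsi (ne_of_mem_I_of_mem_R hi₀ hs) hne').1, hsymm s hs i₀ hi₀]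
    exact ⟨by rw [hsymm s hs i hi, key], key⟩
  · right
    push Not at hS
    have hh : ∀ i ∈ P.I, ∀ j ∈ P.I, i < j → P.asym i j = (0 : J → ℝ) i - (0 : J → ℝ) j :=
      fun i hi j hj _ => by simp [hasym i hi j hj]
    by_cases hb : P.Bullet
    · right
      exact ⟨hcard, ⟨g, hg⟩, hb, by simpa using h.bullet hconn hS hh hb⟩
    · left
      exact ⟨hcard, ⟨g, hg⟩, hb, by simpa using h.circ hconn hS hh hb⟩

theorem IsConsistent.isBuildingBlock_of_relAII [Finite J] (h : P.IsConsistent)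
    (hconn : P.Connective) (hcard : 3 ≤ P.I.ncard)
    (h0 : ∀ i ∈ P.I, ∀ j ∈ P.I, i ≠ j → P.g i j * P.g j i = 0) :
    P.IsAIICirc ∨ P.IsAIIBullet := by
  obtain ⟨m, hm⟩ : P.I.Nonempty := Set.nonempty_of_ncard_ne_zero (by lia)
  have hh : ∀ i ∈ P.I, ∀ j ∈ P.I, i < j → P.asym i j = P.asym i m - P.asym j m :=
    fun i hi j hj hij => h.asym_sub h0 hi hj hm hij
  have hrel : P.RelAII fun i => P.asym i m := fun i hi j hj hij => by
    obtain ⟨e1, e2⟩ := coeff_of_lt (h0 i hi j hj hij.ne) hij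
    exact ⟨e1.trans (hh i hi j hj hij), e2⟩
  -- type `S` with respect to three indices of `I` would make `asym` vanish on `I`
  have hT : ∀ t ∈ P.R, ∀ i ∈ P.I, P.g i t * P.g t i = 0 := by
    intro t ht i hi
    by_contra hne
    obtain ⟨j, hj, hji, -⟩ := exists_third hcard i i
    obtain ⟨k, hk, hki, hkj⟩ := exists_third hcard i j
    have hti := ne_of_mem_I_of_mem_R hi ht
    have htj := ne_of_mem_I_of_mem_R hj ht
    have htk := ne_of_mem_I_of_mem_R hk ht
    obtain ⟨a1, a2, a3⟩ := h.pair_eq hi hj hji.symm hti htj hne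
    obtain ⟨b1, b2, b3⟩ := h.pair_eq hi hk hki.symm hti htk hne
    have hne' : P.g j t * P.g t j ≠ 0 := by rwa [← a1, ← a2, mul_comm]
    obtain ⟨c1, c2, c3⟩ := h.pair_eq hj hk hkj.symm htj htk hne'
    exact asym_ne_zero (h0 i hi j hj hji.symm) hji.symm (by linarith)
  by_cases hb : P.Bullet
  · exact Or.inr ⟨hcard, hb, _, hrel, h.bullet hconn hT hh hb⟩
  · exact Or.inl ⟨hcard, hb, _, hrel, h.circ hconn hT hh hb⟩

theorem IsConsistent.isBuildingBlock_of_pair [Finite J] (h : P.IsConsistent)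
    (hconn : P.Connective) {i j : J} (hij : i < j) (hI : P.I = {i, j}) :
    P.IsBS ∨ P.IsBCirc ∨ P.IsBBullet := by
  have hi : i ∈ P.I := by simp [hI]
  have hj : j ∈ P.I := by simp [hI]
  by_cases hS : ∃ r ∈ P.R, ∃ k ∈ P.I, P.g k r * P.g r k ≠ 0
  · left
    refine ⟨i, j, hij, hI, fun _ => hS, fun s => P.g i s, fun s hs => ?_⟩
    obtain ⟨r, hr, k, hk, hne⟩ := hS
    have hri := ne_of_mem_I_of_mem_R hi hr
    have hrj := ne_of_mem_I_of_mem_R hj hr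
    have hsi := ne_of_mem_I_of_mem_R hi hs
    have hsj := ne_of_mem_I_of_mem_R hj hs
    obtain ⟨-, e1, e2, e3⟩ := (h.pair_dichotomy hi hj hij.ne hri hrj).resolve_right (by
      rintro ⟨z1, z2⟩
      rw [hI] at hk
      rcases hk with rfl | rfl
      exacts [hne z1, hne z2])
    have f1 := h.asym_eq hconn hi hr hs
    have f2 := h.asym_eq hconn hj hr hs
    simp only [asym] at e3 f1 f2
    rcases h.pair_dichotomy hi hj hij.ne hsi hsj with ⟨-, d1, d2, d3⟩ | ⟨z1, z2⟩
    · simp only [asym] at d3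
      exact ⟨rfl, by linarith, by linarith, by linarith⟩
    · -- a one-sided `s` can only lie between `i` and `j`, with `g i s = g s j = asym i j`
      rcases lt_or_gt_of_ne hsi with hlt | hlt
      · have l := h.left s i j hlt hij hi hj
        have n := P.g_ne_zero s i hlt
        have a1 := (coeff_of_gt z1 hlt).2
        have a2 := (coeff_of_gt z2 (hlt.trans hij)).2
        simp only [asym] at l
        exact absurd (by linarith) n
      rcases lt_or_gt_of_ne hsj with hlt' | hlt'
      · have a1 := (coeff_of_lt z1 hlt).2
        have a2 := (coeff_of_gt z2 hlt').2
        exact ⟨rfl, by linarith, by linarith, by linarith⟩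
      · have l := h.right i j s hij hlt' hi hj
        have n := P.g_ne_zero j s hlt'
        have a1 := (coeff_of_lt z1 hlt).2
        have a2 := (coeff_of_lt z2 hlt').2
        simp only [asym] at l
        exact absurd (by linarith) n
  · right
    push Not at hS
    have hh : ∀ a ∈ P.I, ∀ b ∈ P.I, a < b → P.asym a b =
        (fun k => if k = i then 0 else -P.asym i j) a -
        (fun k => if k = i then 0 else -P.asym i j) b := by
      intro a ha b hb hab
      rw [hI] at ha hb
      rcases ha with rfl | rfl <;> rcases hb with rfl | rfl
      · exact absurd hab (lt_irrefl _)
      · simp [hij.ne']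
      · exact absurd hab (lt_asymm hij)
      · exact absurd hab (lt_irrefl _)
    by_cases hb : P.Bullet
    · right
      obtain ⟨cp, cm, hc⟩ := h.bullet hconn hS hh hb
      refine ⟨i, j, hij, hI, hb, cp, cm + P.asym i j, fun t ht => ?_⟩
      obtain ⟨a, ha, b, hb, hab, hbetween, -⟩ := hb
      have hab' : a = i ∧ b = j := by
        rw [hI] at ha hb
        rcases ha with rfl | rfl <;> rcases hb with rfl | rfl
        · exact absurd hab (lt_irrefl _)
        · exact ⟨rfl, rfl⟩
        · exact absurd hab (lt_asymm hij)
        · exact absurd hab (lt_irrefl _)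
      obtain ⟨rfl, rfl⟩ := hab'
      have e1 := (hc t ht a hi).1 (hbetween t ht).1
      have e2 := (hc t ht b hj).2 (hbetween t ht).2
      simp only [if_true, if_neg hij.ne', zero_add, sub_neg_eq_add] at e1 e2
      exact ⟨e1, e2⟩
    · left
      obtain ⟨c, hc⟩ := h.circ hconn hS hh hb
      refine ⟨i, j, hij, hI, hb, c, fun t ht => ?_⟩
      have e1 := hc t ht i hi
      have e2 := hc t ht j hj
      simp only [if_true, if_neg hij.ne', zero_add] at e1 e2
      refine ⟨e1, ?_⟩
      rwa [sub_eq_neg_add]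

theorem IsConsistent.isC (h : P.IsConsistent) (hconn : P.Connective) {i : J}
    (hI : P.I = {i}) : P.IsC := by
  have hi : i ∈ P.I := by simp [hI]
  rcases P.R.eq_empty_or_nonempty with hR | ⟨s, hs⟩
  · exact ⟨i, hI, 0, 0, by simp [hR]⟩
  refine ⟨i, hI, P.asym i s, fun r => P.g i r, fun r hr => ⟨rfl, ?_⟩⟩
  rw [h.asym_eq hconn hi hs hr, asym]
  ring

theorem IsConsistent.isBuildingBlock [Finite J] (h : P.IsConsistent) (hconn : P.Connective) :
    P.IsBuildingBlock := by
  refine ⟨hconn, ?_⟩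
  obtain h0 | h1 | h2 | h3 : P.I.ncard = 0 ∨ P.I.ncard = 1 ∨ P.I.ncard = 2 ∨ 3 ≤ P.I.ncard := by
    lia
  · have hD : P.IsD := (Set.ncard_eq_zero (Set.toFinite _)).mp h0
    tauto
  · obtain ⟨i, hI⟩ := Set.ncard_eq_one.mp h1
    have := h.isC hconn hI
    tauto
  · obtain ⟨i, j, hij, hI⟩ := Set.ncard_eq_two.mp h2
    rcases lt_or_gt_of_ne hij with hlt | hlt
    · have := h.isBuildingBlock_of_pair hconn hlt hI
      tauto
    · have := h.isBuildingBlock_of_pair hconn hlt (hI.trans (Set.pair_comm i j))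
      tauto
  · by_cases hAI : ∃ i ∈ P.I, ∃ j ∈ P.I, i ≠ j ∧ P.g i j * P.g j i ≠ 0
    · obtain ⟨i, hi, j, hj, hij, hne⟩ := hAI
      have := h.isBuildingBlock_of_relAI hconn h3 (h.relAI h3 hi hj hij hne)
      tauto
    · push Not at hAI
      have := h.isBuildingBlock_of_relAII hconn h3 hAI
      tauto

/-! ### Consistency from the basis of ordered monomials -/

theorem relation (P : Relations J) {α β : J} (h : α < β) :
    (P.g α β : ℂ) • (P.D α * P.D β) - (P.g β α : ℂ) • (P.D β * P.D α) =
      P.x β • P.D α - P.x α • P.D β := by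
  simpa only [lhs, rhs, D, map_sub, map_smul, map_mul] using
    RingQuot.mkAlgHom_rel ℂ (Rel.quad (P := P) α β h)

/-- The two ways of reordering `X * Y * Z` in an algebra with three relations of the given form
differ by a combination of ordered monomials of degree at most two. -/
theorem overlap {A : Type} [Ring A] [Algebra ℂ A] {X Y Z : A} {a a' b b' c c' x y z : ℂ}
    (hXY : a • (X * Y) - a' • (Y * X) = y • X - x • Y)
    (hXZ : b • (X * Z) - b' • (Z * X) = z • X - x • Z)
    (hYZ : c • (Y * Z) - c' • (Z * Y) = z • Y - y • Z) :
    (a' * z * (b' + c - c' - b)) • (Y * X) + (b' * y * (c + a - a' - c')) • (Z * X) +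
      (c' * x * (a + b' - a' - b)) • (Z * Y) + (y * z * (c + a - c' - b)) • X +
      (x * z * (c' - a')) • Y + (x * y * (b + a' - a - c)) • Z = 0 := by
  have l1 := congrArg (· * Z) hXY
  have l2 := congrArg (Y * ·) hXZ
  have l3 := congrArg (· * X) hYZ
  have r1 := congrArg (X * ·) hYZ
  have r2 := congrArg (· * Y) hXZ
  have r3 := congrArg (Z * ·) hXY
  simp only [sub_mul, mul_sub, smul_mul_assoc, mul_smul_comm, mul_assoc] at l1 l2 l3 r1 r2 r3
  linear_combination (norm := module) (-(b * c)) • l1 - (a' * c) • l2 - (a' * b') • l3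
    + (a * b) • r1 + (a * c') • r2 + (b' * c') • r3
    - ((a + c) * y) • hXZ + ((b + a') * x) • hYZ + ((c' + b) * z) • hXY

section monomial

variable [Fintype J]

theorem monomial_eq_prod_filter (P : Relations J) (k : J → ℕ) :
    P.monomial k = ((((Finset.univ : Finset J).sort (· ≥ ·)).filter (fun α => k α ≠ 0)).map
      (fun α => P.D α ^ k α)).prod := by
  rw [monomial]
  induction (Finset.univ : Finset J).sort (· ≥ ·) with
  | nil => rfl
  | cons a l ih =>
    by_cases h : k a = 0
    · simp [h, ih]
    · simp [h, ih]

theorem sort_filter_eq {p : J → Prop} [DecidablePred p] {l : List J}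
    (hl : l.Pairwise (· > ·)) (hmem : ∀ a, a ∈ l ↔ p a) :
    ((Finset.univ : Finset J).sort (· ≥ ·)).filter p = l := by
  refine List.Perm.eq_of_pairwise' (r := (· ≥ ·)) ?_ (hl.imp fun h => le_of_lt h) ?_
  · exact (Finset.pairwise_sort _ _).filter _
  · rw [List.perm_ext_iff_of_nodup ((Finset.sort_nodup _ _).filter _) (hl.imp fun h => ne_of_gt h)]
    simp [hmem]

theorem monomial_single (P : Relations J) (i : J) : P.monomial (Pi.single i 1) = P.D i := by
  rw [monomial_eq_prod_filter, sort_filter_eq (l := [i])]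
  · simp
  · simp
  · simp [Pi.single_apply]

theorem monomial_pair (P : Relations J) {i j : J} (hij : i < j) :
    P.monomial (Pi.single j 1 + Pi.single i 1) = P.D j * P.D i := by
  rw [monomial_eq_prod_filter, sort_filter_eq (l := [j, i])]
  · simp [Pi.single_apply, hij.ne, hij.ne']
  · simpa using hij
  · intro a
    by_cases h1 : a = i <;> by_cases h2 : a = j <;> simp [Pi.single_apply, h1, h2]

/-- Linear independence of the ordered monomials makes all coefficients in `overlap` vanish. -/
theorem IsDiffusion.coeff_eq_zero (hP : P.IsDiffusion) {i j k : J} (hij : i < j) (hjk : j < k) :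
    (P.g j i * P.x k * (P.g k i + P.g j k - P.g k j - P.g i k) : ℂ) = 0 ∧
    (P.g k i * P.x j * (P.g j k + P.g i j - P.g j i - P.g k j) : ℂ) = 0 ∧
    (P.g k j * P.x i * (P.g i j + P.g k i - P.g j i - P.g i k) : ℂ) = 0 ∧
    (P.x j * P.x k * (P.g j k + P.g i j - P.g k j - P.g i k) : ℂ) = 0 ∧
    (P.x i * P.x k * (P.g k j - P.g j i) : ℂ) = 0 ∧
    (P.x i * P.x j * (P.g i k + P.g j i - P.g i j - P.g j k) : ℂ) = 0 := by
  have hik := hij.trans hjk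
  have key := overlap (P.relation hij) (P.relation hik) (P.relation hjk)
  let v : Fin 6 → J → ℕ := ![Pi.single j 1 + Pi.single i 1, Pi.single k 1 + Pi.single i 1,
    Pi.single k 1 + Pi.single j 1, Pi.single i 1, Pi.single j 1, Pi.single k 1]
  -- the six exponents are told apart by their values at `i`, `j`, `k`
  have hv : Function.Injective v := by
    refine Function.Injective.of_comp (f := fun e : J → ℕ => (e i, e j, e k)) ?_
    have : (fun e : J → ℕ => (e i, e j, e k)) ∘ v =
        ![(1, 1, 0), (1, 0, 1), (0, 1, 1), (1, 0, 0), (0, 1, 0), (0, 0, 1)] := by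
      funext n
      fin_cases n <;> simp [v, hij.ne, hij.ne', hik.ne, hik.ne', hjk.ne, hjk.ne']
    rw [this]
    decide
  have hlin := Fintype.linearIndependent_iff.mp (hP.1.comp v hv)
    ![_, _, _, _, _, _] (by
      simp only [Fin.sum_univ_six, Function.comp, v]
      simpa [monomial_single, monomial_pair, hij, hjk, hik] using key)
  exact ⟨hlin 0, hlin 1, hlin 2, hlin 3, hlin 4, hlin 5⟩

end monomial

theorem IsDiffusion.isConsistent [Fintype J] (hP : P.IsDiffusion) : P.IsConsistent where
  transport := by
    intro α β γ hαβ hγα hγβ hγ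
    simp only [asym]
    have hx : P.x γ ≠ 0 := hγ
    rcases lt_or_gt_of_ne hγα with h1 | h1
    · have e := (hP.coeff_eq_zero h1 hαβ).2.2.1
      simp only [mul_eq_zero, hx, or_false, Complex.ofReal_eq_zero] at e
      refine e.imp id fun e => ?_
      norm_cast at e
      linarith
    rcases lt_or_gt_of_ne hγβ with h2 | h2
    · have e := (hP.coeff_eq_zero h1 h2).2.1
      simp only [mul_eq_zero, hx, or_false, Complex.ofReal_eq_zero] at e
      refine e.imp id fun e => ?_
      norm_cast at e
      linarith
    · have e := (hP.coeff_eq_zero hαβ h2).1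
      simp only [mul_eq_zero, hx, or_false, Complex.ofReal_eq_zero] at e
      refine e.imp id fun e => ?_
      norm_cast at e
      linarith
  left := by
    intro t i j hti hij hi hj
    have e := (mul_eq_zero.mp (hP.coeff_eq_zero hti hij).2.2.2.1).resolve_left
      (mul_ne_zero hi hj)
    norm_cast at e
    simp only [asym]
    linarith
  middle := by
    intro i t j hit htj hi hj
    have e := (mul_eq_zero.mp (hP.coeff_eq_zero hit htj).2.2.2.2.1).resolve_left
      (mul_ne_zero hi hj)
    norm_cast at e
    linarith
  right := by
    intro i j t hij hjt hi hj
    have e := (mul_eq_zero.mp (hP.coeff_eq_zero hij hjt).2.2.2.2.2).resolve_left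
      (mul_ne_zero hi hj)
    norm_cast at e
    simp only [asym]
    linarith

/-! ### Decomposition into blocks -/

/-- The relations between the generators with indices in `S`. -/
def restrict (P : Relations J) (S : Set J) : Relations S where
  g α β := P.g α β
  x α := P.x α
  g_ne_zero α β h := P.g_ne_zero α β h

theorem IsConsistent.restrict (h : P.IsConsistent) (S : Set J) : (P.restrict S).IsConsistent where
  transport α β γ h1 h2 h3 := h.transport α β γ h1 (Subtype.coe_ne_coe.mpr h2)
    (Subtype.coe_ne_coe.mpr h3)
  left t i j := h.left t i j
  middle i t j := h.middle i t j
  right i j t := h.right i j t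

/-- The equivalence relation on `R` generated by `g r s * g s r ≠ 0`. Its classes are the sets
`U` of the blocks. -/
def linked (P : Relations J) : Setoid P.R where
  r := Relation.ReflTransGen fun a b => P.g a b * P.g b a ≠ 0
  iseqv :=
    have : Std.Symm fun a b : P.R => P.g a b * P.g b a ≠ 0 := ⟨fun a b h => by rwa [mul_comm]⟩
    ⟨fun _ => .refl, fun h => Std.Symm.symm _ _ h, .trans⟩

/-- The index set of a block: `I` together with a class of linked indices, or `I` alone for
`none`. -/
def blockSet (P : Relations J) (o : Option (Quotient P.linked)) : Set J :=
  {a | a ∈ P.I ∨ ∃ ha : a ∈ P.R, o = some (Quotient.mk _ ⟨a, ha⟩)}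

theorem mem_restrict_R {S : Set J} {a : S} : a ∈ (P.restrict S).R ↔ (a : J) ∈ P.R := Iff.rfl

theorem class_eq {o : Option (Quotient P.linked)} {a : J} (h : a ∈ P.blockSet o) (ha : a ∈ P.R) :
    o = some (Quotient.mk _ ⟨a, ha⟩) :=
  (h.resolve_left fun h' => h' ha).2

theorem connective_restrict (P : Relations J) (o : Option (Quotient P.linked)) :
    (P.restrict (P.blockSet o)).Connective := by
  rintro ⟨r, hr⟩ hrR ⟨s, hs⟩ hsR
  rw [mem_restrict_R] at hrR hsR
  have hro := class_eq hr hrR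
  have hpath : Relation.ReflTransGen (fun a b : P.R => P.g a b * P.g b a ≠ 0) ⟨r, hrR⟩ ⟨s, hsR⟩ :=
    Quotient.exact (s := P.linked) (Option.some_injective _ (hro.symm.trans (class_eq hs hsR)))
  -- a path in `R` starting in a class stays in the class
  suffices H : ∀ t : P.R, Relation.ReflTransGen (fun a b : P.R => P.g a b * P.g b a ≠ 0)
      ⟨r, hrR⟩ t → ∀ ht : (t : J) ∈ P.blockSet o, Relation.ReflTransGen
        (fun a b => a ∈ (P.restrict (P.blockSet o)).R ∧ b ∈ (P.restrict (P.blockSet o)).R ∧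
          (P.restrict (P.blockSet o)).g a b * (P.restrict (P.blockSet o)).g b a ≠ 0)
        ⟨r, hr⟩ ⟨t, ht⟩ from H _ hpath hs
  intro t ht
  induction ht with
  | refl => exact fun _ => .refl
  | @tail b c hb hbc ih =>
    intro hc
    have hbo : (b : J) ∈ P.blockSet o :=
      Or.inr ⟨b.2, hro.trans (congrArg some (Quotient.sound (s := P.linked) hb))⟩
    exact (ih hbo).tail ⟨b.2, c.2, hbc⟩

/-- Relations between indices of different classes are one-sided. -/
theorem g_eq_zero_of_class_ne {a b : J} (ha : a ∈ P.R) (hb : b ∈ P.R) (hlt : a < b)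
    (h : (Quotient.mk P.linked ⟨a, ha⟩) ≠ Quotient.mk P.linked ⟨b, hb⟩) : P.g b a = 0 := by
  by_contra hne
  exact h (Quotient.sound (s := P.linked) (.single (mul_ne_zero (P.g_ne_zero a b hlt) hne)))

end Relations

/-! ### The blended algebra -/

section blending

variable {J : Type} [LinearOrder J] [Finite J] {P : Relations J}

/-- Consistent relations as a blending: one block for each class of linked indices, and one block
with empty `U`, which guarantees that there is a block at all. -/
noncomputable def Relations.IsConsistent.blending (h : P.IsConsistent) : Blending J where
  K := Nat.card (Option (Quotient P.linked))
  K_pos := Nat.card_pos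
  X l := {
    J := P.blockSet ((Finite.equivFin _).symm l)
    ord := inferInstance
    rels := P.restrict _
    isBuildingBlock := (h.restrict _).isBuildingBlock (P.connective_restrict _) }
  φ l := OrderEmbedding.subtype _
  cover a := by
    by_cases ha : a ∈ P.I
    · exact ⟨Finite.equivFin _ none, ⟨a, Or.inl ha⟩, rfl⟩
    · have ha' : a ∈ P.R := not_not.mp ha
      exact ⟨Finite.equivFin _ (some (Quotient.mk _ ⟨a, ha'⟩)),
        ⟨a, Or.inr ⟨ha', Equiv.symm_apply_apply _ _⟩⟩, rfl⟩
  image_I l m := by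
    have key : ∀ o, ((↑) : P.blockSet o → J) '' (P.restrict (P.blockSet o)).I = P.I := by
      intro o
      ext a
      exact ⟨fun ⟨b, hb, e⟩ => e ▸ hb, fun ha => ⟨⟨a, Or.inl ha⟩, ha, rfl⟩⟩
    exact (key _).trans (key _).symm
  disjoint_U l m hlm := by
    rw [Set.disjoint_left]
    rintro _ ⟨a, ha, rfl⟩ ⟨b, hb, hab⟩
    refine hlm ((Finite.equivFin _).symm.injective ?_)
    have e1 := Relations.class_eq a.2 ha
    have e2 := Relations.class_eq b.2 hb
    have hab' : (b : J) = a := hab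
    rw [e1, e2]
    simp only [hab']
  same_x l m α _ α' _ e := congrArg P.x e
  same_g l m α _ β _ α' _ β' _ _ e1 e2 := congrArg₂ P.g e1 e2

theorem Relations.IsConsistent.blending_map_eq_of_rel (h : P.IsConsistent) {u v : FreeAlgebra ℂ J}
    (huv : h.blending.Rel u v) :
    RingQuot.mkAlgHom ℂ P.Rel u = RingQuot.mkAlgHom ℂ P.Rel v := by
  cases huv with
  | block l α β hlt => exact RingQuot.mkAlgHom_rel ℂ (Relations.Rel.quad (P := P) α.1 β.1 hlt)
  | cross l m hlm a b ha hb =>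
    have hne : Quotient.mk P.linked ⟨a.1, ha⟩ ≠ Quotient.mk P.linked ⟨b.1, hb⟩ := by
      intro e
      refine hlm ((Finite.equivFin _).symm.injective ?_)
      rw [Relations.class_eq a.2 ha, Relations.class_eq b.2 hb, e]
    -- a one-sided relation without linear part kills the ordered product
    have kill : ∀ a b, (ha : a ∈ P.R) → (hb : b ∈ P.R) → a < b →
        Quotient.mk P.linked ⟨a, ha⟩ ≠ Quotient.mk P.linked ⟨b, hb⟩ → P.D a * P.D b = 0 := by
      intro a b ha hb hlt hne
      have e := P.relation hlt
      have hxa : P.x a = 0 := ha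
      have hxb : P.x b = 0 := hb
      rw [Relations.g_eq_zero_of_class_ne ha hb hlt hne, hxa, hxb] at e
      simpa [P.g_ne_zero a b hlt] using e
    rw [map_zero, normalProd]
    change RingQuot.mkAlgHom ℂ P.Rel (if a.1 < b.1 then FreeAlgebra.ι ℂ a.1 * FreeAlgebra.ι ℂ b.1
      else FreeAlgebra.ι ℂ b.1 * FreeAlgebra.ι ℂ a.1) = 0
    split_ifs with hlt
    · rw [map_mul]
      exact kill _ _ ha hb hlt hne
    · rw [map_mul]
      refine kill _ _ hb ha (lt_of_le_of_ne (not_lt.mp hlt) fun e => hne ?_) hne.symm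
      congr 1
      exact Subtype.ext e.symm

theorem Relations.IsConsistent.map_eq_of_rel (h : P.IsConsistent) {u v : FreeAlgebra ℂ J}
    (huv : P.Rel u v) :
    RingQuot.mkAlgHom ℂ h.blending.Rel u = RingQuot.mkAlgHom ℂ h.blending.Rel v := by
  obtain ⟨α, β, hlt⟩ := huv
  let eqv := Finite.equivFin (Option (Quotient P.linked))
  have same : ∀ o, α ∈ P.blockSet o → β ∈ P.blockSet o →
      RingQuot.mkAlgHom ℂ h.blending.Rel (P.lhs (FreeAlgebra.ι ℂ) α β) =
      RingQuot.mkAlgHom ℂ h.blending.Rel (P.rhs (FreeAlgebra.ι ℂ) α β) := by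
    intro o hα hβ
    obtain ⟨l, rfl⟩ := eqv.symm.surjective o
    exact RingQuot.mkAlgHom_rel ℂ (Blending.Rel.block (B := h.blending) l ⟨α, hα⟩ ⟨β, hβ⟩ hlt)
  by_cases hα : α ∈ P.I
  · by_cases hβ : β ∈ P.I
    · exact same none (Or.inl hα) (Or.inl hβ)
    · exact same _ (Or.inl hα) (Or.inr ⟨not_not.mp hβ, rfl⟩)
  by_cases hβ : β ∈ P.I
  · exact same _ (Or.inr ⟨not_not.mp hα, rfl⟩) (Or.inl hβ)
  have hα' : α ∈ P.R := not_not.mp hα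
  have hβ' : β ∈ P.R := not_not.mp hβ
  by_cases hcl : Quotient.mk P.linked ⟨α, hα'⟩ = Quotient.mk P.linked ⟨β, hβ'⟩
  · exact same _ (Or.inr ⟨hα', rfl⟩) (Or.inr ⟨hβ', congrArg some hcl⟩)
  have hcross := RingQuot.mkAlgHom_rel ℂ (Blending.Rel.cross (B := h.blending)
    (eqv (some (Quotient.mk _ ⟨α, hα'⟩))) (eqv (some (Quotient.mk _ ⟨β, hβ'⟩)))
    (fun e => hcl (Option.some_injective _ (eqv.injective e)))
    ⟨α, Or.inr ⟨hα', eqv.symm_apply_apply _⟩⟩ ⟨β, Or.inr ⟨hβ', eqv.symm_apply_apply _⟩⟩ hα' hβ')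
  have hcross' :
      RingQuot.mkAlgHom ℂ h.blending.Rel (FreeAlgebra.ι ℂ α * FreeAlgebra.ι ℂ β) = 0 := by
    rw [← map_zero (RingQuot.mkAlgHom ℂ h.blending.Rel), ← hcross]
    exact congrArg _ (if_pos hlt).symm
  have hxα : P.x α = 0 := hα'
  have hxβ : P.x β = 0 := hβ'
  rw [Relations.lhs, Relations.rhs, Relations.g_eq_zero_of_class_ne hα' hβ' hlt hcl, hxα, hxβ]
  simp only [Complex.ofReal_zero, zero_smul, sub_zero, map_smul, hcross', smul_zero, map_zero]

/-- Quotients of an algebra by relations that imply each other are isomorphic. -/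
theorem exists_ringQuot_algEquiv {A : Type} [Ring A] [Algebra ℂ A] {r s : A → A → Prop}
    (hrs : ∀ u v, r u v → RingQuot.mkAlgHom ℂ s u = RingQuot.mkAlgHom ℂ s v)
    (hsr : ∀ u v, s u v → RingQuot.mkAlgHom ℂ r u = RingQuot.mkAlgHom ℂ r v) :
    ∃ e : RingQuot r ≃ₐ[ℂ] RingQuot s,
      ∀ u, e (RingQuot.mkAlgHom ℂ r u) = RingQuot.mkAlgHom ℂ s u := by
  refine ⟨AlgEquiv.ofAlgHom (RingQuot.liftAlgHom ℂ ⟨RingQuot.mkAlgHom ℂ s, fun u v => hrs u v⟩)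
    (RingQuot.liftAlgHom ℂ ⟨RingQuot.mkAlgHom ℂ r, fun u v => hsr u v⟩) ?_ ?_, fun u => ?_⟩
  · apply RingQuot.ringQuot_ext'
    ext u
    simp
  · apply RingQuot.ringQuot_ext'
    ext u
    simp
  · simp

end blending

end Diffusion

theorem mainTheorem2 (N : ℕ) (P : Diffusion.Relations (Fin N)) (hP : P.IsDiffusion) :
    ∃ (B : Diffusion.Blending (Fin N)) (e : P.Alg ≃ₐ[ℂ] B.Alg), ∀ α : Fin N, e (P.D α) = B.D α := by
  have h := hP.isConsistent
  obtain ⟨e, he⟩ := Diffusion.exists_ringQuot_algEquiv (fun _ _ => h.map_eq_of_rel)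
    (fun _ _ => h.blending_map_eq_of_rel)
  exact ⟨h.blending, e, fun α => he _⟩
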